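/- Let $E=(E^0,E^1,r,s)$ be a directed graph (with vertex set $E^0$ and edge set $E^1$ of arbitrary cardinality, range map $r$ and source map $s$), and let $R$ be a commutative ring with $1\neq 0$. The graph is row-finite if no vertex emits infinitely many edges, and a sink is a vertex that emits no edge. Finite paths are sequences $\alpha=\alpha_1\cdots\alpha_n$ of edges with $r(\alpha_i)=s(\alpha_{i+1})$, of length $|\alpha|=n$ (vertices are the paths of length $0$), and infinite paths are sequences $p_1p_2\cdots$ of edges with $r(p_i)=s(p_{i+1})$. A finite path $\alpha$ is an initial subpath of an infinite path $p$ if $p=\alpha q$ for some infinite path $q$. The Leavitt path algebra $L_R(E)$ is the universal (not necessarily unital) associative $R$-algebra generated by elements $v$, $e$, $e^*$ ($v\in E^0$, $e\in E^1$), where the $v$ are pairwise orthogonal idempotents and $s(e)e=e\,r(e)=e$, $e^*s(e)=r(e)e^*=e^*$, $e^*f=\delta_{e,f}\,r(e)$ for all $e,f\in E^1$, and $v=\sum_{s(e)=v}ee^*$ for every vertex $v$ that emits a nonzero finite number of edges. For $\alpha=\alpha_1\cdots\alpha_n$ put $\alpha^*=\alpha_n^*\cdots\alpha_1^*$, and $v^*=v$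 for $v\in E^0$. For $n\in\mathbb Z$ let $L_R(E)_n$ be the $R$-linear span of all $\alpha\beta^*$ with $\alpha,\beta$ finite paths, $r(\alpha)=r(\beta)$ and $|\alpha|-|\beta|=n$. The algebra $L_R(E)$ is strongly $\mathbb Z$-graded if $L_R(E)=\bigoplus_{n\in\mathbb Z}L_R(E)_n$, $L_R(E)_mL_R(E)_n\subseteq L_R(E)_{m+n}$ and moreover $L_R(E)_mL_R(E)_n=L_R(E)_{m+n}$ for all $m,n\in\mathbb Z$, where $L_R(E)_mL_R(E)_n$ denotes the additive subgroup generated by the products $ab$ with $a\in L_R(E)_m$, $b\in L_R(E)_n$. **Theorem.** $L_R(E)$ is strongly $\mathbb Z$-graded if and only if $E$ is row-finite, has no sinks, and satisfies Condition (Y): for every $k\in\mathbb N=\{0,1,2,\dots\}$ and every infinite path $p$, there exist an initial subpath $\alpha$ of $p$ and a finite path $\beta$ such that $r(\beta)=r(\alpha)$ and $|\beta|-|\alpha|=k$. -/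

import Mathlib

/-- A directed graph `(E⁰, E¹, r, s)` with vertex set `V`, edge set `E`, source map `s` and
range map `r`. Loops, parallel edges, infinite sets and empty sets are all allowed. -/
structure DirectedGraph (V : Type*) (E : Type*) where
  s : E → V
  r : E → V

namespace DirectedGraph

variable {V : Type*} {E : Type*} (G : DirectedGraph V E)

/-- The set of edges emitted by a vertex. -/
def emits (v : V) : Set E := {e | G.s e = v}

/-- A sink emits no edges. -/
def IsSink (v : V) : Prop := G.emits v = ∅

/-- An infinite emitter emits infinitely many edges. -/
def IsInfiniteEmitter (v : V) : Prop := (G.emits v).Infinite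

/-- A regular vertex is a vertex that is neither a sink nor an infinite emitter. -/
def IsRegular (v : V) : Prop := ¬ G.IsSink v ∧ ¬ G.IsInfiniteEmitter v

/-- A graph is row-finite if it has no infinite emitters. -/
def RowFinite : Prop := ∀ v, ¬ G.IsInfiniteEmitter v

/-- The graph has no sinks. -/
def NoSinks : Prop := ∀ v, ¬ G.IsSink v

/-- `G.IsPath v l w`: the list of edges `l` is a path with source `v` and range `w`, i.e. each edge
starts where the previous one ends. The empty list is the path of length `0` at a vertex. -/
def IsPath : V → List E → V → Prop
  | v, [], w => v = w
  | v, e :: l, w => G.s e = v ∧ IsPath (G.r e) l w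

/-- Finite paths; vertices are the paths of length `0`. -/
structure FinitePath where
  source : V
  edges : List E
  range : V
  isPath : G.IsPath source edges range

/-- The length of a finite path. -/
def FinitePath.length {G : DirectedGraph V E} (α : G.FinitePath) : ℕ := α.edges.length

/-- Infinite paths `p₀ p₁ p₂ …`, with `r (pᵢ) = s (pᵢ₊₁)`. -/
structure InfinitePath where
  edge : ℕ → E
  chain : ∀ i, G.r (edge i) = G.s (edge (i + 1))

/-- The source of an infinite path. -/
def InfinitePath.source {G : DirectedGraph V E} (p : G.InfinitePath) : V := G.s (p.edge 0)

/-- `α` is an initial subpath of the infinite path `p`: there is an infinite path `q` starting at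
the range of `α` such that `p = α q`. -/
def IsInitialSubpath {G : DirectedGraph V E} (α : G.FinitePath) (p : G.InfinitePath) : Prop :=
  ∃ q : G.InfinitePath, α.range = q.source ∧
    (∀ (i : ℕ) (h : i < α.edges.length), p.edge i = α.edges[i]) ∧
    ∀ i : ℕ, p.edge (α.length + i) = q.edge i

/-- Condition (Y). -/
def ConditionY : Prop :=
  ∀ (k : ℕ) (p : G.InfinitePath), ∃ α β : G.FinitePath,
    IsInitialSubpath α p ∧ β.range = α.range ∧ (β.length : ℤ) - (α.length : ℤ) = (k : ℤ)

/-- A Leavitt `G`-family in a (not necessarily unital) ring: elements `v`, `e`, `e^*` satisfying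
the defining relations. -/
structure IsLeavittFamily {A : Type*} [NonUnitalRing A]
    (vert : V → A) (edge : E → A) (ghost : E → A) : Prop where
  idem : ∀ v, vert v * vert v = vert v
  orth : ∀ v w, v ≠ w → vert v * vert w = 0
  source_edge : ∀ e, vert (G.s e) * edge e = edge e
  edge_range : ∀ e, edge e * vert (G.r e) = edge e
  ghost_source : ∀ e, ghost e * vert (G.s e) = ghost e
  range_ghost : ∀ e, vert (G.r e) * ghost e = ghost e
  ck1_self : ∀ e, ghost e * edge e = vert (G.r e)
  ck1_ne : ∀ e f, e ≠ f → ghost e * edge f = 0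
  ck2 : ∀ v, G.IsRegular v → ∀ S : Finset E, (S : Set E) = G.emits v →
    vert v = ∑ e ∈ S, edge e * ghost e

end DirectedGraph

/-- The symbols that generate the Leavitt path algebra: `v`, `e` and `e^*`. -/
inductive LeavittGen (V : Type*) (E : Type*)
  | vert (v : V)
  | edge (e : E)
  | ghost (e : E)

/-- The free associative (non-unital) `R`-algebra on the generating symbols: the semigroup algebra
of the free semigroup, i.e. polynomials without constant term in non-commuting variables. -/
abbrev LeavittFree (R : Type*) [CommRing R] (V : Type*) (E : Type*) :=
  MonoidAlgebra R (FreeSemigroup (LeavittGen V E))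

namespace LeavittFree

variable (R : Type*) [CommRing R] {V : Type*} {E : Type*}

/-- The variable of the free algebra attached to a generating symbol. -/
noncomputable def gen (x : LeavittGen V E) : LeavittFree R V E :=
  MonoidAlgebra.single (FreeSemigroup.of x) 1

/-- The defining relations of the Leavitt path algebra. -/
inductive BaseRel (G : DirectedGraph V E) : LeavittFree R V E → LeavittFree R V E → Prop
  | idem (v : V) : BaseRel G (gen R (.vert v) * gen R (.vert v)) (gen R (.vert v))
  | orth (v w : V) (h : v ≠ w) : BaseRel G (gen R (.vert v) * gen R (.vert w)) 0
  | source_edge (e : E) : BaseRel G (gen R (.vert (G.s e)) * gen R (.edge e)) (gen R (.edge e))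
  | edge_range (e : E) : BaseRel G (gen R (.edge e) * gen R (.vert (G.r e))) (gen R (.edge e))
  | ghost_source (e : E) : BaseRel G (gen R (.ghost e) * gen R (.vert (G.s e))) (gen R (.ghost e))
  | range_ghost (e : E) : BaseRel G (gen R (.vert (G.r e)) * gen R (.ghost e)) (gen R (.ghost e))
  | ck1_self (e : E) : BaseRel G (gen R (.ghost e) * gen R (.edge e)) (gen R (.vert (G.r e)))
  | ck1_ne (e f : E) (h : e ≠ f) : BaseRel G (gen R (.ghost e) * gen R (.edge f)) 0
  | ck2 (v : V) (hv : G.IsRegular v) (S : Finset E) (hS : (S : Set E) = G.emits v) :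
      BaseRel G (gen R (.vert v)) (∑ e ∈ S, gen R (.edge e) * gen R (.ghost e))

/-- The smallest `R`-algebra congruence containing the defining relations. -/
inductive Rel (G : DirectedGraph V E) : LeavittFree R V E → LeavittFree R V E → Prop
  | base {a b} : BaseRel R G a b → Rel G a b
  | refl (a) : Rel G a a
  | symm {a b} : Rel G a b → Rel G b a
  | trans {a b c} : Rel G a b → Rel G b c → Rel G a c
  | add {a b c d} : Rel G a b → Rel G c d → Rel G (a + c) (b + d)
  | mul {a b c d} : Rel G a b → Rel G c d → Rel G (a * c) (b * d)
  | smul (t : R) {a b} : Rel G a b → Rel G (t • a) (t • b)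

/-- `Rel` as a ring congruence. -/
noncomputable def con (G : DirectedGraph V E) : RingCon (LeavittFree R V E) where
  r := Rel R G
  iseqv := ⟨Rel.refl, Rel.symm, Rel.trans⟩
  add' := Rel.add
  mul' := Rel.mul

end LeavittFree

/-- The Leavitt path algebra `L_R(G)`: the (in general non-unital) associative `R`-algebra
presented by the generators `v`, `e`, `e^*` and the relations of a Leavitt `G`-family. -/
def LeavittPathAlgebra (R : Type*) [CommRing R] {V : Type*} {E : Type*}
    (G : DirectedGraph V E) :=
  (LeavittFree.con R G).Quotient

namespace LeavittPathAlgebra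

variable (R : Type*) [CommRing R] {V : Type*} {E : Type*} (G : DirectedGraph V E)

noncomputable instance : NonUnitalRing (LeavittPathAlgebra R G) :=
  inferInstanceAs (NonUnitalRing (LeavittFree.con R G).Quotient)

/-- The quotient map from the free algebra. -/
noncomputable def mk (a : LeavittFree R V E) : LeavittPathAlgebra R G :=
  ((a : (LeavittFree.con R G).Quotient))

variable {R G} in
theorem mk_surjective : Function.Surjective (mk R G) := Quotient.mk_surjective

variable {R G} in
theorem mk_eq_mk {a b : LeavittFree R V E} : mk R G a = mk R G b ↔ LeavittFree.Rel R G a b :=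
  (LeavittFree.con R G).eq

theorem mk_zero : mk R G 0 = 0 := rfl

theorem mk_add (a b : LeavittFree R V E) : mk R G (a + b) = mk R G a + mk R G b := rfl

theorem mk_mul (a b : LeavittFree R V E) : mk R G (a * b) = mk R G a * mk R G b := rfl

noncomputable instance : SMul R (LeavittPathAlgebra R G) where
  smul t := Quotient.map (fun a => t • a) (fun _ _ h => LeavittFree.Rel.smul t h)

theorem mk_smul (t : R) (a : LeavittFree R V E) : mk R G (t • a) = t • mk R G a := rfl

noncomputable instance : Module R (LeavittPathAlgebra R G) where
  one_smul x := by
    obtain ⟨a, rfl⟩ := mk_surjective x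
    rw [← mk_smul, one_smul]
  mul_smul t u x := by
    obtain ⟨a, rfl⟩ := mk_surjective x
    simp only [← mk_smul, mul_smul]
  smul_zero t := by
    rw [← mk_zero, ← mk_smul, smul_zero]
  smul_add t x y := by
    obtain ⟨a, rfl⟩ := mk_surjective x
    obtain ⟨b, rfl⟩ := mk_surjective y
    simp only [← mk_smul, ← mk_add, smul_add]
  add_smul t u x := by
    obtain ⟨a, rfl⟩ := mk_surjective x
    simp only [← mk_smul, ← mk_add, add_smul]
  zero_smul x := by
    obtain ⟨a, rfl⟩ := mk_surjective x
    rw [← mk_smul, zero_smul, mk_zero]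

instance : IsScalarTower R (LeavittPathAlgebra R G) (LeavittPathAlgebra R G) where
  smul_assoc t x y := by
    obtain ⟨a, rfl⟩ := mk_surjective x
    obtain ⟨b, rfl⟩ := mk_surjective y
    simp only [smul_eq_mul, ← mk_smul, ← mk_mul, smul_mul_assoc]

instance : SMulCommClass R (LeavittPathAlgebra R G) (LeavittPathAlgebra R G) where
  smul_comm t x y := by
    obtain ⟨a, rfl⟩ := mk_surjective x
    obtain ⟨b, rfl⟩ := mk_surjective y
    simp only [smul_eq_mul, ← mk_smul, ← mk_mul, mul_smul_comm]

/-- The generator `v`. -/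
noncomputable def vert (v : V) : LeavittPathAlgebra R G := mk R G (LeavittFree.gen R (.vert v))

/-- The generator `e`. -/
noncomputable def edge (e : E) : LeavittPathAlgebra R G := mk R G (LeavittFree.gen R (.edge e))

/-- The generator `e^*`. -/
noncomputable def ghost (e : E) : LeavittPathAlgebra R G := mk R G (LeavittFree.gen R (.ghost e))

/-- The quotient map as a homomorphism of non-unital `R`-algebras. -/
noncomputable def mkHom : LeavittFree R V E →ₙₐ[R] LeavittPathAlgebra R G where
  toFun := mk R G
  map_smul' := mk_smul R G
  map_zero' := mk_zero R G
  map_add' := mk_add R G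
  map_mul' := mk_mul R G

/-- The generators form a Leavitt family. -/
theorem isLeavittFamily : G.IsLeavittFamily (vert R G) (edge R G) (ghost R G) where
  idem v := mk_eq_mk.2 (.base (.idem v))
  orth v w h := mk_eq_mk.2 (.base (.orth v w h))
  source_edge e := mk_eq_mk.2 (.base (.source_edge e))
  edge_range e := mk_eq_mk.2 (.base (.edge_range e))
  ghost_source e := mk_eq_mk.2 (.base (.ghost_source e))
  range_ghost e := mk_eq_mk.2 (.base (.range_ghost e))
  ck1_self e := mk_eq_mk.2 (.base (.ck1_self e))
  ck1_ne e f h := mk_eq_mk.2 (.base (.ck1_ne e f h))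
  ck2 v hv S hS := by
    have h : mk R G (LeavittFree.gen R (.vert v)) =
        mkHom R G (∑ e ∈ S, LeavittFree.gen R (.edge e) * LeavittFree.gen R (.ghost e)) :=
      mk_eq_mk.2 (.base (.ck2 v hv S hS))
    rw [map_sum] at h
    exact h

/-- The universal property: a Leavitt family in any `R`-algebra `A` is the image of the generators
under exactly one homomorphism of `R`-algebras. -/
theorem existsUnique_lift {A : Type*} [NonUnitalRing A] [Module R A] [IsScalarTower R A A]
    [SMulCommClass R A A] {v : V → A} {e e' : E → A} (h : G.IsLeavittFamily v e e') :
    ∃! f : LeavittPathAlgebra R G →ₙₐ[R] A,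
      (∀ x, f (vert R G x) = v x) ∧ (∀ x, f (edge R G x) = e x) ∧
        ∀ x, f (ghost R G x) = e' x := by
  let φ : LeavittGen V E → A := fun x => match x with
    | .vert x => v x
    | .edge x => e x
    | .ghost x => e' x
  let F : LeavittFree R V E →ₙₐ[R] A := MonoidAlgebra.liftMagma R (FreeSemigroup.lift φ)
  have hF : ∀ x, F (LeavittFree.gen R x) = φ x := fun x => by
    simp [F, LeavittFree.gen, MonoidAlgebra.liftMagma]
  have hrel : ∀ a b, LeavittFree.Rel R G a b → F a = F b := by
    intro a b hab
    induction hab with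
    | base hb =>
      cases hb with
      | idem x => simpa [hF, φ] using h.idem x
      | orth x y hxy => simpa [hF, φ] using h.orth x y hxy
      | source_edge x => simpa [hF, φ] using h.source_edge x
      | edge_range x => simpa [hF, φ] using h.edge_range x
      | ghost_source x => simpa [hF, φ] using h.ghost_source x
      | range_ghost x => simpa [hF, φ] using h.range_ghost x
      | ck1_self x => simpa [hF, φ] using h.ck1_self x
      | ck1_ne x y hxy => simpa [hF, φ] using h.ck1_ne x y hxy
      | ck2 x hx S hS => simpa [hF, φ, map_sum] using h.ck2 x hx S hS
    | refl a => rfl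
    | symm _ ih => exact ih.symm
    | trans _ _ ih1 ih2 => exact ih1.trans ih2
    | add _ _ ih1 ih2 => rw [map_add, map_add, ih1, ih2]
    | mul _ _ ih1 ih2 => rw [map_mul, map_mul, ih1, ih2]
    | smul t _ ih => rw [map_smul, map_smul, ih]
  let f : LeavittPathAlgebra R G →ₙₐ[R] A :=
    { toFun := Quotient.lift F hrel
      map_smul' := fun t x => by
        obtain ⟨a, rfl⟩ := mk_surjective x
        exact map_smul F t a
      map_zero' := map_zero F
      map_add' := fun x y => by
        obtain ⟨a, rfl⟩ := mk_surjective x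
        obtain ⟨b, rfl⟩ := mk_surjective y
        exact map_add F a b
      map_mul' := fun x y => by
        obtain ⟨a, rfl⟩ := mk_surjective x
        obtain ⟨b, rfl⟩ := mk_surjective y
        exact map_mul F a b }
  refine ⟨f, ⟨fun x => hF _, fun x => hF _, fun x => hF _⟩, ?_⟩
  rintro g ⟨h1, h2, h3⟩
  have key : g.comp (mkHom R G) = F := by
    apply (MonoidAlgebra.liftMagma R).symm.injective
    apply FreeSemigroup.hom_ext
    funext x
    have hx : g (mk R G (LeavittFree.gen R x)) = F (LeavittFree.gen R x) := by
      rw [hF]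
      cases x with
      | vert x => exact h1 x
      | edge x => exact h2 x
      | ghost x => exact h3 x
    exact hx
  ext x
  obtain ⟨a, rfl⟩ := mk_surjective x
  exact DFunLike.congr_fun key a

/-- The element of the algebra given by a path with source `v` and edges `e₁, …, eₙ`: it is `v` if
`n = 0`, and `e₁ ⋯ eₙ = e₁ ⋯ eₙ r(eₙ)` otherwise. -/
noncomputable def pathElem : V → List E → LeavittPathAlgebra R G
  | v, [] => vert R G v
  | _, e :: l => edge R G e * pathElem (G.r e) l

/-- The element `α^*` of the algebra given by a path `α` with source `v` and edges `e₁, …, eₙ`: it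
is `v` if `n = 0`, and `eₙ^* ⋯ e₁^* = r(eₙ) eₙ^* ⋯ e₁^*` otherwise. -/
noncomputable def ghostElem : V → List E → LeavittPathAlgebra R G
  | v, [] => vert R G v
  | _, e :: l => ghostElem (G.r e) l * ghost R G e

/-- The canonical homogeneous component of degree `n`: the `R`-span of all `α β^*` with
`r(α) = r(β)` and `|α| - |β| = n`. -/
noncomputable def component (n : ℤ) : Submodule R (LeavittPathAlgebra R G) :=
  Submodule.span R {x | ∃ α β : G.FinitePath, α.range = β.range ∧
    n = (α.length : ℤ) - (β.length : ℤ) ∧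
    x = pathElem R G α.source α.edges * ghostElem R G β.source β.edges}

end LeavittPathAlgebra

/-- `A` is a `Γ`-graded ring with homogeneous components `𝒜 γ`: it is their internal direct sum,
and `A_γ A_δ ⊆ A_{γ+δ}` (the group is written additively). The ring need not be unital. -/
structure IsGradedBy {Γ : Type*} [AddGroup Γ] [DecidableEq Γ] {A : Type*} [NonUnitalRing A]
    (𝒜 : Γ → AddSubgroup A) : Prop where
  isInternal : DirectSum.IsInternal 𝒜
  mul_mem : ∀ γ δ, ∀ a ∈ 𝒜 γ, ∀ b ∈ 𝒜 δ, a * b ∈ 𝒜 (γ + δ)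

/-- `A` is strongly `Γ`-graded: it is `Γ`-graded and `A_γ A_δ = A_{γ+δ}` for all `γ, δ`, where
`A_γ A_δ` is the additive subgroup generated by the products. -/
structure IsStronglyGradedBy {Γ : Type*} [AddGroup Γ] [DecidableEq Γ] {A : Type*}
    [NonUnitalRing A] (𝒜 : Γ → AddSubgroup A) : Prop extends IsGradedBy 𝒜 where
  mul_eq : ∀ γ δ,
    AddSubgroup.closure {x | ∃ a ∈ 𝒜 γ, ∃ b ∈ 𝒜 δ, x = a * b} = 𝒜 (γ + δ)

/-!
Write `L` for the Leavitt path algebra and `L_n` for the span of the monomials `α β^*` of degree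
`n`.

That `L` is graded is true for every graph. Left multiplication by a generator maps monomials
to monomials or to `0`, whence `L_m L_n ⊆ L_{m+n}` (`component_mul_mem`) and `L = ∑ L_n`; the sum is
direct because the universal property yields a homomorphism to Laurent polynomials that sends
`x ∈ L_n` to `x Tⁿ` (`exists_toLaurent`). Laurent polynomials are taken over the unitization of `L`,
as `L` need not have a `1`.

Since the vertices are local units, the grading is strong if and only if every vertex `v` lies in
`L_n L_{-n}` for every `n` (`componentMul_eq_of_vert_mem`).

*Necessity.* If `v ∈ L_n L_{-n}`, then `y v ≠ 0` forces `y α ≠ 0` for one of finitely many paths `α`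
that occur in monomials `α β^*` of degree `n` (`isLeftControlled_of_mem_componentMul`). For `n = 1`
these paths have positive length; as `e^* v = e^* ≠ 0` for every edge `e` emitted by `v`, and `v ≠ 0`,
the vertex `v` emits at least one and at most finitely many edges. For `n = -k` and an infinite path
`p` from `v`, take `y = p_N^*` for an initial subpath `p_N` of `p` at least as long as these `α`:
`p_N^* α ≠ 0` says that `α` is an initial subpath of `p`, and `|β| - |α| = k`. All this rests on the
fact that vertices are nonzero in `L` (`vert_ne_zero`), which follows from an explicit
representation on functions.

*Sufficiency.* For `n ≥ 0`, the relation `v = ∑ e e^*` gives `v ∈ L_n L_{-n}` by induction. For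
`n = -k < 0`, if `v ∉ L_{-k} L_k`, then `α α^* = ∑ α e e^* α^*` allows the construction, edge by edge,
of an infinite path all of whose initial subpaths `α` satisfy `α α^* ∉ L_{-k} L_k`. Condition (Y)
provides one of them and some `β` with `α α^* = (α β^*) (β α^*) ∈ L_{-k} L_k`, a contradiction
(`vert_mem_componentMul_neg`).
-/

namespace DirectedGraph

variable {V : Type*} {E : Type*} {G : DirectedGraph V E}

/-! ### Finite and infinite paths -/

theorem IsPath.range_unique {v w w' : V} {l : List E} (h : G.IsPath v l w)
    (h' : G.IsPath v l w') : w = w' := by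
  induction l generalizing v with
  | nil => exact Eq.trans (Eq.symm h) h'
  | cons e l ih => exact ih h.2 h'.2

theorem IsPath.append_singleton {v : V} {l : List E} {e : E} (h : G.IsPath v l (G.s e)) :
    G.IsPath v (l ++ [e]) (G.r e) := by
  induction l generalizing v with
  | nil => exact ⟨Eq.symm h, rfl⟩
  | cons f l ih => exact ⟨h.1, ih h.2⟩

theorem FinitePath.ext_of_source_edges {α β : G.FinitePath} (hs : α.source = β.source)
    (he : α.edges = β.edges) : α = β := by
  obtain ⟨v, l, w, h⟩ := α
  obtain ⟨v', l', w', h'⟩ := β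
  dsimp only at hs he
  subst hs he
  obtain rfl := h.range_unique h'
  rfl

/-- The path of length `0` at a vertex. -/
def FinitePath.nil (G : DirectedGraph V E) (v : V) : G.FinitePath := ⟨v, [], v, rfl⟩

/-- The path `e α`. -/
def FinitePath.cons (e : E) (α : G.FinitePath) (h : G.r e = α.source) : G.FinitePath :=
  ⟨G.s e, e :: α.edges, α.range, rfl, h ▸ α.isPath⟩

/-- The path `α e`. -/
def FinitePath.snoc (α : G.FinitePath) (e : E) (h : G.s e = α.range) : G.FinitePath :=
  ⟨α.source, α.edges ++ [e], G.r e, IsPath.append_singleton (h ▸ α.isPath)⟩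

theorem InfinitePath.isPath_map_range (p : G.InfinitePath) (n : ℕ) :
    G.IsPath p.source ((List.range n).map p.edge) (G.s (p.edge n)) := by
  induction n with
  | zero => exact rfl
  | succ n ih =>
    rw [List.range_succ, List.map_append, List.map_singleton, ← p.chain n]
    exact ih.append_singleton

/-- The initial subpath of length `n` of an infinite path. -/
def InfinitePath.take (p : G.InfinitePath) (n : ℕ) : G.FinitePath :=
  ⟨p.source, (List.range n).map p.edge, G.s (p.edge n), p.isPath_map_range n⟩

theorem InfinitePath.length_take (p : G.InfinitePath) (n : ℕ) : (p.take n).length = n := by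
  simp [InfinitePath.take, FinitePath.length]

theorem InfinitePath.isInitialSubpath_take (p : G.InfinitePath) (n : ℕ) :
    IsInitialSubpath (p.take n) p := by
  refine ⟨⟨fun i => p.edge (n + i), fun i => p.chain (n + i)⟩, rfl, ?_, ?_⟩
  · intro i hi
    simp [InfinitePath.take]
  · intro i
    rw [p.length_take]

theorem IsInitialSubpath.eq_take {α : G.FinitePath} {p : G.InfinitePath}
    (h : IsInitialSubpath α p) : α = p.take α.length := by
  obtain ⟨q, hr, h1, h2⟩ := h
  have he : α.edges = (List.range α.length).map p.edge := by
    apply List.ext_getElem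
    · simp [FinitePath.length]
    · intro i hi _
      simp [h1 i hi]
  refine FinitePath.ext_of_source_edges ?_ he
  obtain ⟨v, l, w, hp⟩ := α
  cases l with
  | nil =>
    have h20 := h2 0
    simp only [FinitePath.length, List.length_nil, Nat.add_zero] at h20
    change v = G.s (p.edge 0)
    rw [h20]
    exact Eq.trans hp hr
  | cons e l =>
    change v = G.s (p.edge 0)
    rw [h1 0 (by simp)]
    exact hp.1.symm

/-- A property of finite paths that holds at a vertex and can always be kept while extending the
path by an edge holds for all initial subpaths of some infinite path. -/
theorem exists_infinitePath_forall_take (Q : G.FinitePath → Prop) {v : V} (hv : Q (.nil G v))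
    (hQ : ∀ α, Q α → ∃ (e : E) (h : G.s e = α.range), Q (α.snoc e h)) :
    ∃ p : G.InfinitePath, ∀ n, Q (p.take n) := by
  have : Nonempty E := ⟨(hQ _ hv).choose⟩
  choose! e he using hQ
  let a : ℕ → {α : G.FinitePath // Q α} := fun n =>
    Nat.rec ⟨.nil G v, hv⟩ (fun _ α => ⟨α.1.snoc (e α.1) (he α.1 α.2).1, (he α.1 α.2).2⟩) n
  let p : G.InfinitePath :=
    { edge := fun n => e (a n).1
      chain := fun n => (he (a (n + 1)).1 (a (n + 1)).2).1.symm }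
  have hp : p.source = v := (he (a 0).1 (a 0).2).1
  have ha : ∀ n, p.take n = (a n).1 := by
    intro n
    induction n with
    | zero => exact FinitePath.ext_of_source_edges hp rfl
    | succ n ih =>
      refine FinitePath.ext_of_source_edges ?_ ?_
      · exact (congrArg FinitePath.source ih :)
      · have h := congrArg FinitePath.edges ih
        simp only [InfinitePath.take] at h ⊢
        rw [List.range_succ, List.map_append, h]
        rfl
  exact ⟨p, fun n => ha n ▸ (a n).2⟩

theorem InfinitePath.take_eq_of_prefix {p : G.InfinitePath} {n : ℕ} {α : G.FinitePath}
    (hs : α.source = p.source) (h : α.edges <+: (p.take n).edges) : α = p.take α.length := by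
  refine FinitePath.ext_of_source_edges hs ?_
  have hl : α.length ≤ n := by
    have := h.length_le
    rwa [← FinitePath.length, ← FinitePath.length, p.length_take] at this
  rw [List.prefix_iff_eq_take.1 h]
  simp only [InfinitePath.take]
  rw [← List.map_take, List.take_range, ← FinitePath.length, Nat.min_eq_left hl]

end DirectedGraph

namespace LeavittPathAlgebra

open DirectedGraph

section Elements

variable {R : Type*} [CommRing R] {V : Type*} {E : Type*} {G : DirectedGraph V E}

/-! ### The elements given by paths -/

theorem vert_mul_pathElem {v w : V} {l : List E} (h : G.IsPath v l w) :
    vert R G v * pathElem R G v l = pathElem R G v l := by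
  cases l with
  | nil => exact (isLeavittFamily R G).idem v
  | cons e l =>
    obtain ⟨rfl, -⟩ := h
    simp only [pathElem, ← mul_assoc, (isLeavittFamily R G).source_edge]

theorem ghostElem_mul_vert {v w : V} {l : List E} (h : G.IsPath v l w) :
    ghostElem R G v l * vert R G v = ghostElem R G v l := by
  cases l with
  | nil => exact (isLeavittFamily R G).idem v
  | cons e l =>
    obtain ⟨rfl, -⟩ := h
    simp only [ghostElem, mul_assoc, (isLeavittFamily R G).ghost_source]

theorem pathElem_mul_vert {v w : V} {l : List E} (h : G.IsPath v l w) :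
    pathElem R G v l * vert R G w = pathElem R G v l := by
  induction l generalizing v with
  | nil => obtain rfl := h; exact (isLeavittFamily R G).idem v
  | cons e l ih => simp only [pathElem, mul_assoc, ih h.2]

theorem vert_mul_ghostElem {v w : V} {l : List E} (h : G.IsPath v l w) :
    vert R G w * ghostElem R G v l = ghostElem R G v l := by
  induction l generalizing v with
  | nil => obtain rfl := h; exact (isLeavittFamily R G).idem v
  | cons e l ih => simp only [ghostElem, ← mul_assoc, ih h.2]

theorem pathElem_append_singleton {v : V} {l : List E} {e : E} (h : G.IsPath v l (G.s e)) :
    pathElem R G v (l ++ [e]) = pathElem R G v l * edge R G e := by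
  induction l generalizing v with
  | nil =>
    obtain rfl := h
    simp [pathElem, (isLeavittFamily R G).source_edge, (isLeavittFamily R G).edge_range]
  | cons f l ih => simp only [List.cons_append, pathElem, ih h.2, mul_assoc]

theorem ghostElem_append_singleton {v : V} {l : List E} {e : E} (h : G.IsPath v l (G.s e)) :
    ghostElem R G v (l ++ [e]) = ghost R G e * ghostElem R G v l := by
  induction l generalizing v with
  | nil =>
    obtain rfl := h
    simp [ghostElem, (isLeavittFamily R G).ghost_source, (isLeavittFamily R G).range_ghost]
  | cons f l ih => simp only [List.cons_append, ghostElem, ih h.2, mul_assoc]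

theorem ghostElem_mul_pathElem_self {v w : V} {l : List E} (h : G.IsPath v l w) :
    ghostElem R G v l * pathElem R G v l = vert R G w := by
  induction l generalizing v with
  | nil => obtain rfl := h; exact (isLeavittFamily R G).idem v
  | cons e l ih =>
    simp only [ghostElem, pathElem]
    rw [mul_assoc, ← mul_assoc (ghost R G e), (isLeavittFamily R G).ck1_self,
      vert_mul_pathElem h.2, ih h.2]

theorem vert_mul_pathElem_of_ne {u v w : V} {l : List E} (h : G.IsPath v l w) (huv : u ≠ v) :
    vert R G u * pathElem R G v l = 0 := by
  rw [← vert_mul_pathElem h, ← mul_assoc, (isLeavittFamily R G).orth u v huv, zero_mul]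

/-- If `β^* α ≠ 0` and `α` is not longer than `β`, then `α` is an initial segment of `β`. -/
theorem isPrefix_of_ghostElem_mul_pathElem_ne_zero {v w w' : V} {l l' : List E}
    (h : G.IsPath v l w) (h' : G.IsPath v l' w') (hl : l'.length ≤ l.length)
    (hne : ghostElem R G v l * pathElem R G v l' ≠ 0) : l' <+: l := by
  induction l' generalizing v l with
  | nil => exact List.nil_prefix
  | cons e' l' ih =>
    cases l with
    | nil => simp at hl
    | cons e l =>
      simp only [ghostElem, pathElem] at hne
      rw [mul_assoc, ← mul_assoc (ghost R G e)] at hne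
      by_cases hee : e = e'
      · subst hee
        rw [(isLeavittFamily R G).ck1_self, vert_mul_pathElem h'.2] at hne
        exact List.cons_prefix_cons.2 ⟨rfl, ih h.2 h'.2 (by simpa using hl) hne⟩
      · rw [(isLeavittFamily R G).ck1_ne e e' hee, zero_mul, mul_zero] at hne
        exact absurd rfl hne

/-! ### Multiplication of the homogeneous components -/

theorem pathElem_mul_ghostElem_mem (α β : G.FinitePath) (h : α.range = β.range) (n : ℤ)
    (hn : n = (α.length : ℤ) - (β.length : ℤ)) :
    pathElem R G α.source α.edges * ghostElem R G β.source β.edges ∈ component R G n :=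
  Submodule.subset_span ⟨α, β, h, hn, rfl⟩

theorem pathElem_mem_component (α : G.FinitePath) :
    pathElem R G α.source α.edges ∈ component R G α.length := by
  have := pathElem_mul_ghostElem_mem (R := R) α (.nil G α.range) rfl α.length (by
    simp [FinitePath.nil, FinitePath.length])
  simpa only [FinitePath.nil, ghostElem, pathElem_mul_vert α.isPath] using this

theorem ghostElem_mem_component (α : G.FinitePath) :
    ghostElem R G α.source α.edges ∈ component R G (-α.length) := by
  have := pathElem_mul_ghostElem_mem (R := R) (.nil G α.range) α rfl (-α.length) (by
    simp [FinitePath.nil, FinitePath.length])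
  simpa only [FinitePath.nil, pathElem, vert_mul_ghostElem α.isPath] using this

/-- A left multiplication maps `L_n` to `L_m` as soon as it does so on the spanning elements. -/
theorem mul_mem_component_of_forall {a : LeavittPathAlgebra R G} {n m : ℤ}
    (h : ∀ α β : G.FinitePath, α.range = β.range → n = (α.length : ℤ) - (β.length : ℤ) →
      a * (pathElem R G α.source α.edges * ghostElem R G β.source β.edges) ∈ component R G m)
    {x : LeavittPathAlgebra R G} (hx : x ∈ component R G n) : a * x ∈ component R G m := by
  induction hx using Submodule.span_induction with
  | mem x hx =>
    obtain ⟨α, β, hr, hn, rfl⟩ := hx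
    exact h α β hr hn
  | zero => rw [mul_zero]; exact Submodule.zero_mem _
  | add x y _ _ hx hy => rw [mul_add]; exact Submodule.add_mem _ hx hy
  | smul t x _ hx => rw [mul_smul_comm]; exact Submodule.smul_mem _ t hx

theorem vert_mul_mem {v : V} {n : ℤ} {x : LeavittPathAlgebra R G}
    (hx : x ∈ component R G n) : vert R G v * x ∈ component R G n := by
  refine mul_mem_component_of_forall (fun α β hr hn => ?_) hx
  rw [← mul_assoc]
  by_cases hv : v = α.source
  · subst hv
    rw [vert_mul_pathElem α.isPath]
    exact pathElem_mul_ghostElem_mem α β hr n hn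
  · rw [vert_mul_pathElem_of_ne α.isPath hv, zero_mul]
    exact Submodule.zero_mem _

theorem edge_mul_mem {e : E} {n : ℤ} {x : LeavittPathAlgebra R G}
    (hx : x ∈ component R G n) : edge R G e * x ∈ component R G (1 + n) := by
  refine mul_mem_component_of_forall (fun α β hr hn => ?_) hx
  rw [← mul_assoc]
  by_cases hv : G.r e = α.source
  · have := pathElem_mul_ghostElem_mem (R := R) (.cons e α hv) β hr (1 + n) (by
      simp only [FinitePath.cons, FinitePath.length, List.length_cons] at hn ⊢
      omega)
    simpa only [FinitePath.cons, pathElem, hv] using this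
  · rw [← (isLeavittFamily R G).edge_range, mul_assoc (edge R G e),
      vert_mul_pathElem_of_ne α.isPath hv, mul_zero, zero_mul]
    exact Submodule.zero_mem _

theorem ghost_mul_mem {e : E} {n : ℤ} {x : LeavittPathAlgebra R G}
    (hx : x ∈ component R G n) : ghost R G e * x ∈ component R G (-1 + n) := by
  refine mul_mem_component_of_forall (fun α β hr hn => ?_) hx
  obtain ⟨v, l, w, hp⟩ := α
  dsimp only at hr hn ⊢
  cases l with
  | nil =>
    obtain rfl := hp
    rw [pathElem, hr, vert_mul_ghostElem β.isPath]
    by_cases hv : G.s e = β.range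
    · have := ghostElem_mem_component (R := R) (β.snoc e hv)
      rw [show -((β.snoc e hv).length : ℤ) = -1 + n by
        simp only [FinitePath.snoc, FinitePath.length, List.length_append, List.length_nil,
          List.length_cons] at hn ⊢
        omega] at this
      simpa only [FinitePath.snoc,
        ghostElem_append_singleton (R := R) (e := e) (hv.symm ▸ β.isPath)] using this
    · rw [← vert_mul_ghostElem β.isPath, ← (isLeavittFamily R G).ghost_source,
        mul_assoc (ghost R G e), ← mul_assoc (vert R G _),
        (isLeavittFamily R G).orth _ _ hv, zero_mul, mul_zero]
      exact Submodule.zero_mem _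
  | cons f l =>
    rw [pathElem, ← mul_assoc, ← mul_assoc]
    by_cases hf : e = f
    · subst hf
      rw [(isLeavittFamily R G).ck1_self, vert_mul_pathElem hp.2]
      refine pathElem_mul_ghostElem_mem ⟨G.r e, l, w, hp.2⟩ β hr (-1 + n) ?_
      simp only [FinitePath.length, List.length_cons] at hn ⊢
      omega
    · rw [(isLeavittFamily R G).ck1_ne e f hf, zero_mul, zero_mul]
      exact Submodule.zero_mem _

theorem pathElem_mul_mem {v : V} {l : List E} {n : ℤ} {x : LeavittPathAlgebra R G}
    (hx : x ∈ component R G n) : pathElem R G v l * x ∈ component R G (l.length + n) := by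
  induction l generalizing v with
  | nil => simpa [pathElem] using vert_mul_mem hx
  | cons e l ih =>
    rw [pathElem, mul_assoc]
    convert edge_mul_mem ih using 2
    push_cast [List.length_cons]
    ring

theorem ghostElem_mul_mem {v : V} {l : List E} {n : ℤ} {x : LeavittPathAlgebra R G}
    (hx : x ∈ component R G n) : ghostElem R G v l * x ∈ component R G (-l.length + n) := by
  induction l generalizing v n x with
  | nil => simpa [ghostElem] using vert_mul_mem hx
  | cons e l ih =>
    rw [ghostElem, mul_assoc]
    convert ih (ghost_mul_mem hx) using 2
    push_cast [List.length_cons]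
    ring

theorem component_mul_mem {m n : ℤ} {x y : LeavittPathAlgebra R G}
    (hx : x ∈ component R G m) (hy : y ∈ component R G n) :
    x * y ∈ component R G (m + n) := by
  induction hx using Submodule.span_induction with
  | mem x hx =>
    obtain ⟨α, β, -, hm, rfl⟩ := hx
    rw [mul_assoc]
    convert pathElem_mul_mem (ghostElem_mul_mem hy) using 2
    rw [hm, FinitePath.length, FinitePath.length]
    ring
  | zero => rw [zero_mul]; exact Submodule.zero_mem _
  | add x x' _ _ h h' => rw [add_mul]; exact Submodule.add_mem _ h h'
  | smul t x _ h => rw [smul_mul_assoc]; exact Submodule.smul_mem _ t h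

/-! ### The grading -/

theorem vert_mem_component (v : V) : vert R G v ∈ component R G 0 :=
  pathElem_mem_component (.nil G v)

theorem edge_mem_component (e : E) : edge R G e ∈ component R G 1 := by
  simpa [(isLeavittFamily R G).edge_range] using edge_mul_mem (e := e)
    (vert_mem_component (R := R) (G := G) (G.r e))

theorem ghost_mem_component (e : E) : ghost R G e ∈ component R G (-1) := by
  simpa [(isLeavittFamily R G).ghost_source] using ghost_mul_mem (e := e)
    (vert_mem_component (R := R) (G := G) (G.s e))

/-- The generators are homogeneous, hence so is every monomial in them. -/
theorem exists_mem_component_single (w : FreeSemigroup (LeavittGen V E)) :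
    ∃ n, mk R G (MonoidAlgebra.single w 1) ∈ component R G n := by
  have hgen : ∀ x : LeavittGen V E, ∃ n, mk R G (LeavittFree.gen R x) ∈ component R G n := by
    rintro (v | e | e)
    · exact ⟨_, vert_mem_component v⟩
    · exact ⟨_, edge_mem_component e⟩
    · exact ⟨_, ghost_mem_component e⟩
  induction w using FreeSemigroup.recOnMul with
  | ih1 x => exact hgen x
  | ih2 x y hx hy =>
    obtain ⟨m, hm⟩ := hx
    obtain ⟨n, hn⟩ := hy
    refine ⟨m + n, ?_⟩
    rw [← one_mul (1 : R), ← MonoidAlgebra.single_mul_single, mk_mul]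
    exact component_mul_mem hm hn

theorem mem_of_forall_component_le (S : AddSubmonoid (LeavittPathAlgebra R G))
    (h : ∀ n, ∀ x ∈ component R G n, x ∈ S) (x : LeavittPathAlgebra R G) : x ∈ S := by
  obtain ⟨a, rfl⟩ := mk_surjective x
  induction a using MonoidAlgebra.induction_linear with
  | zero => exact S.zero_mem
  | add a b ha hb => exact S.add_mem ha hb
  | single w t =>
    obtain ⟨n, hn⟩ := exists_mem_component_single (R := R) (G := G) w
    refine h n _ ?_
    rw [← mul_one t, ← smul_eq_mul, ← MonoidAlgebra.smul_single, mk_smul]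
    exact Submodule.smul_mem _ t hn

variable (R G) in
/-- The homomorphism `L → L̃[T, T⁻¹]`, with `L̃` the unitization of `L`, that maps a
homogeneous element `x` of degree `n` to `x Tⁿ`. -/
theorem exists_toLaurent :
    ∃ f : LeavittPathAlgebra R G →ₙₐ[R]
        AddMonoidAlgebra (Unitization R (LeavittPathAlgebra R G)) ℤ,
      ∀ n, ∀ x ∈ component R G n, f x = AddMonoidAlgebra.single n (x : Unitization R _) := by
  have L := isLeavittFamily R G
  have hfam : G.IsLeavittFamily
      (A := AddMonoidAlgebra (Unitization R (LeavittPathAlgebra R G)) ℤ)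
      (fun v => AddMonoidAlgebra.single 0 (vert R G v : Unitization R _))
      (fun e => AddMonoidAlgebra.single 1 (edge R G e : Unitization R _))
      (fun e => AddMonoidAlgebra.single (-1) (ghost R G e : Unitization R _)) := by
    constructor
    · intro v
      simp only [AddMonoidAlgebra.single_mul_single, ← Unitization.inr_mul, L.idem, add_zero]
    · intro v w h
      simp only [AddMonoidAlgebra.single_mul_single, ← Unitization.inr_mul, L.orth v w h,
        Unitization.inr_zero, AddMonoidAlgebra.single_zero]
    · intro e
      simp only [AddMonoidAlgebra.single_mul_single, ← Unitization.inr_mul, L.source_edge, zero_add]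
    · intro e
      simp only [AddMonoidAlgebra.single_mul_single, ← Unitization.inr_mul, L.edge_range, add_zero]
    · intro e
      simp only [AddMonoidAlgebra.single_mul_single, ← Unitization.inr_mul, L.ghost_source, add_zero]
    · intro e
      simp only [AddMonoidAlgebra.single_mul_single, ← Unitization.inr_mul, L.range_ghost, zero_add]
    · intro e
      simp only [AddMonoidAlgebra.single_mul_single, ← Unitization.inr_mul, L.ck1_self, neg_add_cancel]
    · intro e f h
      simp only [AddMonoidAlgebra.single_mul_single, ← Unitization.inr_mul, L.ck1_ne e f h,
        Unitization.inr_zero, AddMonoidAlgebra.single_zero]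
    · intro v hv S hS
      simp only [AddMonoidAlgebra.single_mul_single, ← Unitization.inr_mul, L.ck2 v hv S hS,
        add_neg_cancel]
      exact map_sum ((AddMonoidAlgebra.singleAddHom (0 : ℤ)).comp
        (Unitization.inrHom R R (LeavittPathAlgebra R G)).toAddMonoidHom) _ S
  obtain ⟨f, ⟨hv, he, hg⟩, -⟩ := existsUnique_lift R G hfam
  have hpath : ∀ (l : List E) (v : V),
      f (pathElem R G v l) =
        AddMonoidAlgebra.single (l.length : ℤ) (pathElem R G v l : Unitization R _) := by
    intro l
    induction l with
    | nil => intro v; exact hv v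
    | cons e l ih =>
      intro v
      rw [pathElem, map_mul, ih, he, AddMonoidAlgebra.single_mul_single, ← Unitization.inr_mul]
      congr 1
      push_cast [List.length_cons]
      ring
  have hghost : ∀ (l : List E) (v : V),
      f (ghostElem R G v l) =
        AddMonoidAlgebra.single (-(l.length : ℤ)) (ghostElem R G v l : Unitization R _) := by
    intro l
    induction l with
    | nil => intro v; simpa [ghostElem] using hv v
    | cons e l ih =>
      intro v
      rw [ghostElem, map_mul, ih, hg, AddMonoidAlgebra.single_mul_single, ← Unitization.inr_mul]
      congr 1
      push_cast [List.length_cons]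
      ring
  refine ⟨f, fun n x hx => ?_⟩
  induction hx using Submodule.span_induction with
  | mem x hx =>
    obtain ⟨α, β, -, hn, rfl⟩ := hx
    rw [map_mul, hpath, hghost, AddMonoidAlgebra.single_mul_single, ← Unitization.inr_mul, hn,
      FinitePath.length, FinitePath.length, sub_eq_add_neg]
  | zero => simp
  | add x y _ _ hx hy => rw [map_add, hx, hy, Unitization.inr_add, AddMonoidAlgebra.single_add]
  | smul t x _ hx => rw [map_smul, hx, Unitization.inr_smul, AddMonoidAlgebra.smul_single]

variable (R G) in
theorem isGradedBy_component :
    IsGradedBy (fun n : ℤ => (component R G n).toAddSubgroup) where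
  isInternal := by
    constructor
    · obtain ⟨f, hf⟩ := exists_toLaurent R G
      have key : ∀ x : DirectSum ℤ fun n : ℤ => (component R G n).toAddSubgroup, ∀ n,
          (f (DirectSum.coeAddMonoidHom _ x)).coeff n =
            ((x n : LeavittPathAlgebra R G) : Unitization R _) := by
        intro x n
        induction x using DirectSum.induction_on with
        | zero => simp
        | of i x =>
          rw [DirectSum.coeAddMonoidHom_of, hf i x x.2]
          by_cases h : i = n
          · subst h
            rw [DirectSum.of_eq_same, AddMonoidAlgebra.coeff_single, Finsupp.single_eq_same]
          · rw [DirectSum.of_eq_of_ne _ _ _ (Ne.symm h)]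
            rw [AddMonoidAlgebra.coeff_single, Finsupp.single_eq_of_ne (Ne.symm h)]
            rfl
        | add x y hx hy => simp [hx, hy]
      intro x y hxy
      refine DFinsupp.ext fun n => Subtype.ext ?_
      apply Unitization.inr_injective (R := R)
      rw [← key, ← key, hxy]
    · intro x
      refine mem_of_forall_component_le (AddMonoidHom.mrange (DirectSum.coeAddMonoidHom _))
        (fun n x hx => ?_) x
      exact ⟨DirectSum.of (fun n : ℤ => (component R G n).toAddSubgroup) n ⟨x, hx⟩,
        DirectSum.coeAddMonoidHom_of _ _ _⟩
  mul_mem _ _ _ ha _ hb := component_mul_mem ha hb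

end Elements

/-! ### Vertices are nonzero -/

section Representation

variable {R : Type*} [CommRing R] {κ X : Type*}

/-- The partial isometry `R^X → R^X` attached to two maps `i j : κ → X`: for injective maps it
carries the coordinate at `j x` to the coordinate at `i x`, and all coordinates outside the range
of `i` become `0`. -/
noncomputable def partialIsometry (R : Type*) [CommRing R] {κ X : Type*} (i j : κ → X) :
    Module.End R (X → R) :=
  Function.ExtendByZero.linearMap R i ∘ₗ LinearMap.funLeft R R j

theorem partialIsometry_apply (i j : κ → X) (f : X → R) (a : X) :
    partialIsometry R i j f a = Function.extend i (f ∘ j) 0 a := rfl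

theorem partialIsometry_apply_range {i : κ → X} (hi : i.Injective) (j : κ → X) (f : X → R)
    (x : κ) : partialIsometry R i j f (i x) = f (j x) := by
  rw [partialIsometry_apply, hi.extend_apply, Function.comp_apply]

theorem partialIsometry_apply_of_forall_ne {i : κ → X} (j : κ → X) (f : X → R) {a : X}
    (ha : ∀ x, i x ≠ a) : partialIsometry R i j f a = 0 := by
  rw [partialIsometry_apply, Function.extend_apply' _ _ _ (by simpa using ha), Pi.zero_apply]

theorem partialIsometry_mul {i j : κ → X} (k : κ → X) (hj : j.Injective) :
    partialIsometry R i j * partialIsometry R j k = partialIsometry R i k := by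
  refine LinearMap.ext fun f => funext fun a => ?_
  rw [Module.End.mul_apply, partialIsometry_apply, partialIsometry_apply]
  congr 1
  exact funext fun x => partialIsometry_apply_range hj k f x

theorem partialIsometry_mul_of_disjoint {i j j' k : κ → X} (h : ∀ x y, j' y ≠ j x) :
    partialIsometry R i j * partialIsometry R j' k = 0 := by
  refine LinearMap.ext fun f => funext fun a => ?_
  rw [Module.End.mul_apply, partialIsometry_apply]
  have : partialIsometry R j' k f ∘ j = 0 :=
    funext fun x => partialIsometry_apply_of_forall_ne k f (h x)
  rw [this, LinearMap.zero_apply, Pi.zero_apply]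
  exact congrFun (Function.extend_zero i) a

theorem partialIsometry_mul_of_comp_left {i : κ → X} (hi : i.Injective) (g : κ → κ) (k : κ → X) :
    partialIsometry R i i * partialIsometry R (i ∘ g) k = partialIsometry R (i ∘ g) k := by
  refine LinearMap.ext fun f => funext fun a => ?_
  rw [Module.End.mul_apply]
  by_cases h : ∃ x, i x = a
  · obtain ⟨x, rfl⟩ := h
    rw [partialIsometry_apply_range hi]
  · rw [not_exists] at h
    rw [partialIsometry_apply_of_forall_ne _ _ h,
      partialIsometry_apply_of_forall_ne (i := i ∘ g) _ _ fun x => h (g x)]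

theorem partialIsometry_mul_of_comp_right {i : κ → X} (hi : i.Injective) (g : κ → κ)
    (k : κ → X) :
    partialIsometry R k (i ∘ g) * partialIsometry R i i = partialIsometry R k (i ∘ g) := by
  refine LinearMap.ext fun f => funext fun a => ?_
  rw [Module.End.mul_apply, partialIsometry_apply, partialIsometry_apply]
  congr 1
  exact funext fun x => partialIsometry_apply_range hi i f (g x)

end Representation

/-- For every vertex `u` that is not a sink, `(e, x) ↦ join e x` is a bijection between `s⁻¹(u) × κ`
and `κ`, where `κ = ℕ ⊕ E`. It exists because `κ` is infinite and `|s⁻¹(u)| ≤ |κ|`. -/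
theorem exists_join {V : Type*} {E : Type*} (G : DirectedGraph V E) :
    ∃ join : E → ℕ ⊕ E → ℕ ⊕ E,
      (∀ e f x y, G.s e = G.s f → join e x = join f y → e = f ∧ x = y) ∧
      ∀ u, ¬ G.IsSink u → ∀ x, ∃ e y, G.s e = u ∧ join e y = x := by
  have hφ : ∀ u, ¬ G.IsSink u → Nonempty ((G.emits u) × (ℕ ⊕ E) ≃ ℕ ⊕ E) := by
    intro u hu
    rw [← Cardinal.eq, Cardinal.mk_prod, Cardinal.lift_id, Cardinal.lift_id]
    refine Cardinal.mul_eq_right (Cardinal.infinite_iff.1 inferInstance) ?_ ?_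
    · exact Cardinal.mk_le_of_injective (f := fun e : G.emits u => Sum.inr e.1)
        (Sum.inr_injective.comp Subtype.val_injective)
    · rw [Cardinal.mk_ne_zero_iff, Set.nonempty_coe_sort, Set.nonempty_iff_ne_empty]
      exact hu
  have hs : ∀ e, ¬ G.IsSink (G.s e) := fun e h =>
    Set.notMem_empty e (h ▸ (rfl : G.s e = G.s e) : e ∈ (∅ : Set E))
  have φ : ∀ u, ¬ G.IsSink u → (G.emits u) × (ℕ ⊕ E) ≃ ℕ ⊕ E := fun u hu => (hφ u hu).some
  refine ⟨fun e x => φ (G.s e) (hs e) (⟨e, rfl⟩, x), ?_, ?_⟩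
  · intro e f x y hef h
    have key : ∀ u (hu : ¬ G.IsSink u) (hf : G.s f = u),
        φ (G.s f) (hs f) (⟨f, rfl⟩, y) = φ u hu (⟨f, hf⟩, y) := by
      rintro _ _ rfl
      rfl
    simpa [Subtype.ext_iff] using (φ _ _).injective (h.trans (key (G.s e) (hs e) hef.symm))
  · intro u hu x
    obtain ⟨⟨⟨e, rfl⟩, y⟩, h⟩ := (φ u hu).surjective x
    exact ⟨e, y, rfl, h⟩

/-- The algebra acts on the functions `V × κ → R`, where a vertex `v` acts as the projection onto
the functions supported on `{v} × κ`, which is nonzero. An edge `e` carries the coordinate at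
`(r(e), x)` to the coordinate at `(s(e), join e x)`. -/
theorem vert_ne_zero (R : Type*) [CommRing R] [Nontrivial R] {V E : Type*}
    (G : DirectedGraph V E) (v : V) : vert R G v ≠ 0 := by
  obtain ⟨join, hinj, hsurj⟩ := exists_join G
  let j : V → ℕ ⊕ E → V × (ℕ ⊕ E) := Prod.mk
  let i : E → ℕ ⊕ E → V × (ℕ ⊕ E) := fun e => j (G.s e) ∘ join e
  have hj : ∀ u, (j u).Injective := Prod.mk_right_injective
  have hi : ∀ e, (i e).Injective := fun e x y h =>
    (hinj e e x y rfl (hj _ h)).2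
  have hfam : G.IsLeavittFamily (A := Module.End R (V × (ℕ ⊕ E) → R))
      (fun u => partialIsometry R (j u) (j u))
      (fun e => partialIsometry R (i e) (j (G.r e)))
      (fun e => partialIsometry R (j (G.r e)) (i e)) := by
    constructor
    · exact fun u => partialIsometry_mul _ (hj u)
    · exact fun u w h => partialIsometry_mul_of_disjoint fun x y hxy =>
        h (congrArg Prod.fst hxy).symm
    · exact fun e => partialIsometry_mul_of_comp_left (hj _) _ _
    · exact fun e => partialIsometry_mul _ (hj _)
    · exact fun e => partialIsometry_mul_of_comp_right (hj _) _ _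
    · exact fun e => partialIsometry_mul _ (hj _)
    · exact fun e => partialIsometry_mul _ (hi e)
    · intro e f h
      refine partialIsometry_mul_of_disjoint fun x y hxy => h ?_
      exact (hinj e f x y (congrArg Prod.fst hxy).symm (congrArg Prod.snd hxy).symm).1
    · intro u hu S hS
      have hmem : ∀ e, e ∈ S ↔ G.s e = u := fun e => by
        rw [← Finset.mem_coe, hS]; rfl
      refine LinearMap.ext fun f => funext fun ⟨w, x⟩ => ?_
      simp only [partialIsometry_mul _ (hj _), LinearMap.sum_apply, Finset.sum_apply]
      by_cases hw : w = u
      · subst hw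
        obtain ⟨e, y, rfl, rfl⟩ := hsurj w hu.1 x
        rw [Finset.sum_eq_single_of_mem e ((hmem e).2 rfl)]
        · exact (partialIsometry_apply_range (hj _) _ f _).trans
            (partialIsometry_apply_range (hi e) (i e) f y).symm
        · intro e' _ hne
          exact partialIsometry_apply_of_forall_ne _ _ fun x hx =>
            hne (hinj e' e x y (congrArg Prod.fst hx) (congrArg Prod.snd hx)).1
      · rw [partialIsometry_apply_of_forall_ne _ _ fun x hx => hw (congrArg Prod.fst hx).symm]
        refine (Finset.sum_eq_zero fun e he => ?_).symm
        exact partialIsometry_apply_of_forall_ne _ _ fun x hx =>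
          hw ((congrArg Prod.fst hx).symm.trans ((hmem e).1 he))
  obtain ⟨F, ⟨hF, -⟩, -⟩ := existsUnique_lift R G hfam
  intro h0
  have h1 := hF v
  rw [h0, map_zero] at h1
  have h2 := congrFun (LinearMap.congr_fun h1 fun _ => 1) (j v (.inl 0))
  rw [partialIsometry_apply_range (hj v)] at h2
  exact zero_ne_one h2

section StronglyGraded

variable {R : Type*} [CommRing R] {V : Type*} {E : Type*} {G : DirectedGraph V E}

/-! ### Products of components -/

variable (R G) in
/-- The additive subgroup `L_m L_n` generated by the products `a b` with `a ∈ L_m`, `b ∈ L_n`. -/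
noncomputable def componentMul (m n : ℤ) : AddSubgroup (LeavittPathAlgebra R G) :=
  AddSubgroup.closure {x | ∃ a ∈ (component R G m).toAddSubgroup,
    ∃ b ∈ (component R G n).toAddSubgroup, x = a * b}

theorem mul_mem_componentMul {m n : ℤ} {a b : LeavittPathAlgebra R G}
    (ha : a ∈ component R G m) (hb : b ∈ component R G n) : a * b ∈ componentMul R G m n :=
  AddSubgroup.subset_closure ⟨a, ha, b, hb, rfl⟩

theorem componentMul_le (m n : ℤ) :
    componentMul R G m n ≤ (component R G (m + n)).toAddSubgroup := by
  refine (AddSubgroup.closure_le _).2 ?_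
  rintro _ ⟨a, ha, b, hb, rfl⟩
  exact component_mul_mem ha hb

theorem mul_mem_componentMul_of_left {i m n : ℤ} {a x : LeavittPathAlgebra R G}
    (ha : a ∈ component R G i) (hx : x ∈ componentMul R G m n) :
    a * x ∈ componentMul R G (i + m) n := by
  induction hx using AddSubgroup.closure_induction with
  | mem x hx =>
    obtain ⟨b, hb, c, hc, rfl⟩ := hx
    rw [← mul_assoc]
    exact mul_mem_componentMul (component_mul_mem ha hb) hc
  | zero => rw [mul_zero]; exact AddSubgroup.zero_mem _
  | add x y _ _ hx hy => rw [mul_add]; exact AddSubgroup.add_mem _ hx hy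
  | neg x _ hx => rw [mul_neg]; exact AddSubgroup.neg_mem _ hx

theorem mul_mem_componentMul_of_right {m n i : ℤ} {x b : LeavittPathAlgebra R G}
    (hx : x ∈ componentMul R G m n) (hb : b ∈ component R G i) :
    x * b ∈ componentMul R G m (n + i) := by
  induction hx using AddSubgroup.closure_induction with
  | mem x hx =>
    obtain ⟨a, ha, c, hc, rfl⟩ := hx
    rw [mul_assoc]
    exact mul_mem_componentMul ha (component_mul_mem hc hb)
  | zero => rw [zero_mul]; exact AddSubgroup.zero_mem _
  | add x y _ _ hx hy => rw [add_mul]; exact AddSubgroup.add_mem _ hx hy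
  | neg x _ hx => rw [neg_mul]; exact AddSubgroup.neg_mem _ hx

/-- As the vertices are local units, the products only have to be checked on them. -/
theorem componentMul_eq_of_vert_mem (h : ∀ (v : V) (n : ℤ), vert R G v ∈ componentMul R G n (-n))
    (m n : ℤ) : componentMul R G m n = (component R G (m + n)).toAddSubgroup := by
  refine le_antisymm (componentMul_le m n) fun x hx => ?_
  have hx' : x ∈ component R G (m + n) := hx
  clear hx
  induction hx' using Submodule.closure_induction with
  | zero => exact AddSubgroup.zero_mem _
  | add x y _ _ hx hy => exact AddSubgroup.add_mem _ hx hy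
  | smul_mem t x hx =>
    have hmem : t • x ∈ component R G (m + n) :=
      Submodule.smul_mem _ t (Submodule.subset_span hx)
    obtain ⟨α, β, -, -, rfl⟩ := hx
    have hv := mul_mem_componentMul_of_right (h α.source m) hmem
    rwa [mul_smul_comm, ← mul_assoc, vert_mul_pathElem α.isPath, neg_add_cancel_left] at hv

/-! ### Necessity -/

/-- There is a finite set of paths `α`, each of which occurs in a monomial `α β^*` of degree `n`,
such that every `y` with `y α = 0` for all these `α` annihilates `x` from the left. -/
def IsLeftControlled (n : ℤ) (x : LeavittPathAlgebra R G) : Prop :=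
  ∃ F : Set G.FinitePath, F.Finite ∧
    (∀ α ∈ F, ∃ β : G.FinitePath, α.range = β.range ∧ n = (α.length : ℤ) - (β.length : ℤ)) ∧
    ∀ y, (∀ α ∈ F, y * pathElem R G α.source α.edges = 0) → y * x = 0

theorem isLeftControlled_zero (n : ℤ) : IsLeftControlled n (0 : LeavittPathAlgebra R G) :=
  ⟨∅, Set.finite_empty, by simp, by simp⟩

theorem IsLeftControlled.of_forall {n : ℤ} {a b c : LeavittPathAlgebra R G}
    (ha : IsLeftControlled n a) (hb : IsLeftControlled n b)
    (hc : ∀ y, y * a = 0 → y * b = 0 → y * c = 0) : IsLeftControlled n c := by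
  obtain ⟨F, hF, hF1, hF2⟩ := ha
  obtain ⟨F', hF', hF1', hF2'⟩ := hb
  exact ⟨F ∪ F', hF.union hF', fun α hα => hα.elim (hF1 α) (hF1' α), fun y hy =>
    hc y (hF2 y fun α hα => hy α (.inl hα)) (hF2' y fun α hα => hy α (.inr hα))⟩

theorem isLeftControlled_of_mem_componentMul {n m : ℤ} {x : LeavittPathAlgebra R G}
    (hx : x ∈ componentMul R G n m) : IsLeftControlled n x := by
  induction hx using AddSubgroup.closure_induction with
  | mem x hx =>
    obtain ⟨a, ha, b, -, rfl⟩ := hx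
    have ha' : a ∈ component R G n := ha
    clear ha
    induction ha' using Submodule.span_induction with
    | mem a ha =>
      obtain ⟨α, β, hr, hn, rfl⟩ := ha
      refine ⟨{α}, Set.finite_singleton α, ?_, fun y hy => ?_⟩
      · rintro _ rfl
        exact ⟨β, hr, hn⟩
      · rw [← mul_assoc, ← mul_assoc, hy α rfl, zero_mul, zero_mul]
    | zero => rw [zero_mul]; exact isLeftControlled_zero n
    | add a a' _ _ h h' =>
      exact h.of_forall h' fun y h h' => by rw [add_mul, mul_add, h, h', add_zero]
    | smul t a _ h =>
      exact h.of_forall h fun y h _ => by rw [smul_mul_assoc, mul_smul_comm, h, smul_zero]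
  | zero => exact isLeftControlled_zero n
  | add x y _ _ hx hy => exact hx.of_forall hy fun y h h' => by rw [mul_add, h, h', add_zero]
  | neg x _ hx => exact hx.of_forall hx fun y h _ => by rw [mul_neg, h, neg_zero]

/-- The paths that control `v ∈ L_1 L_{-1}` on the left have positive length. If `v` is a sink, then
none of them starts at `v`, so that `v = v v = 0`. If `v` is an infinite emitter, then some edge `e`
emitted by `v` begins none of them, so that `e^* = e^* v = 0`. -/
theorem isRegular_of_vert_mem_componentMul [Nontrivial R] {v : V}
    (h : vert R G v ∈ componentMul R G 1 (-1)) : G.IsRegular v := by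
  obtain ⟨F, hF, hF1, hF2⟩ := isLeftControlled_of_mem_componentMul h
  have hne : ∀ α ∈ F, α.edges ≠ [] := by
    intro α hα hnil
    obtain ⟨β, -, hβ⟩ := hF1 α hα
    rw [FinitePath.length, hnil, List.length_nil] at hβ
    omega
  constructor
  · intro hsink
    apply vert_ne_zero R G v
    rw [← (isLeavittFamily R G).idem v]
    refine hF2 _ fun α hα => vert_mul_pathElem_of_ne α.isPath ?_
    rintro rfl
    obtain ⟨v, l, w, hp⟩ := α
    cases l with
    | nil => exact hne _ hα rfl
    | cons e l => exact Set.notMem_empty e (hsink ▸ (hp.1 : e ∈ G.emits v))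
  · intro hinf
    -- an edge emitted by `v` that is not the first edge of any path in `F`
    obtain ⟨e, he, heF⟩ := hinf.exists_notMem_finite
      ((hF.image fun α => α.edges.head?).preimage (Option.some_injective E).injOn)
    have h0 : ghost R G e * vert R G v = 0 := by
      refine hF2 _ fun α hα => ?_
      have hα' := hne α hα
      have hhead : α.edges.head? ≠ some e := fun h => heF ⟨α, hα, h⟩
      obtain ⟨v', l, w, hp⟩ := α
      cases l with
      | nil => exact absurd rfl hα'
      | cons f l =>
        rw [pathElem, ← mul_assoc, (isLeavittFamily R G).ck1_ne e f, zero_mul]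
        rintro rfl
        exact hhead rfl
    obtain rfl : G.s e = v := he
    rw [(isLeavittFamily R G).ghost_source] at h0
    apply vert_ne_zero R G (G.r e)
    rw [← (isLeavittFamily R G).ck1_self, h0, zero_mul]

/-- If `s(p) ∈ L_{-k} L_k` and `pₙ` is a long initial subpath of `p`, then `pₙ^* s(p) ≠ 0`, so
that some `α` with a monomial `α β^*` of degree `-k` is an initial subpath of `pₙ`. -/
theorem exists_isInitialSubpath_of_vert_mem_componentMul [Nontrivial R] (p : G.InfinitePath)
    (k : ℕ) (h : vert R G p.source ∈ componentMul R G (-k) k) :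
    ∃ α β : G.FinitePath, IsInitialSubpath α p ∧ β.range = α.range ∧
      (β.length : ℤ) - (α.length : ℤ) = (k : ℤ) := by
  obtain ⟨F, hF, hF1, hF2⟩ := isLeftControlled_of_mem_componentMul h
  obtain ⟨n, hn⟩ := (hF.image FinitePath.length).bddAbove
  have hp : G.IsPath p.source (p.take n).edges (p.take n).range := (p.take n).isPath
  have hne : ghostElem R G p.source (p.take n).edges * vert R G p.source ≠ 0 := by
    rw [ghostElem_mul_vert hp]
    intro h0
    apply vert_ne_zero R G (p.take n).range
    rw [← ghostElem_mul_pathElem_self hp]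
    rw [h0, zero_mul]
  obtain ⟨α, hα, hα0⟩ : ∃ α ∈ F, ghostElem R G p.source (p.take n).edges *
      pathElem R G α.source α.edges ≠ 0 := by
    by_contra! hall
    exact hne (hF2 _ hall)
  obtain ⟨β, hr, hk⟩ := hF1 α hα
  have hs : α.source = p.source := by
    by_contra hs
    apply hα0
    rw [← ghostElem_mul_vert hp, mul_assoc, vert_mul_pathElem_of_ne α.isPath (Ne.symm hs),
      mul_zero]
  have hpre : α.edges <+: (p.take n).edges := by
    refine isPrefix_of_ghostElem_mul_pathElem_ne_zero (R := R) hp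
      (hs ▸ α.isPath) ?_ (hs ▸ hα0)
    exact (hn ⟨α, hα, rfl⟩).trans_eq (p.length_take n).symm
  refine ⟨α, β, ?_, hr.symm, by omega⟩
  rw [InfinitePath.take_eq_of_prefix hs hpre]
  exact p.isInitialSubpath_take _

/-! ### Sufficiency -/

theorem vert_mem_of_forall_edge {S : AddSubgroup (LeavittPathAlgebra R G)} {v : V}
    (hv : G.IsRegular v) {a b : LeavittPathAlgebra R G}
    (h : ∀ e, G.s e = v → a * (edge R G e * ghost R G e) * b ∈ S) : a * vert R G v * b ∈ S := by
  have hfin : (G.emits v).Finite := Set.not_infinite.1 hv.2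
  rw [(isLeavittFamily R G).ck2 v hv hfin.toFinset hfin.coe_toFinset, Finset.mul_sum,
    Finset.sum_mul]
  exact S.sum_mem fun e he => h e (hfin.mem_toFinset.1 he)

theorem vert_mem_componentMul_natCast (hG : ∀ v, G.IsRegular v) (n : ℕ) (v : V) :
    vert R G v ∈ componentMul R G n (-n) := by
  have L := isLeavittFamily R G
  induction n generalizing v with
  | zero =>
    rw [← L.idem]
    exact mul_mem_componentMul (vert_mem_component v) (by simpa using vert_mem_component v)
  | succ n ih =>
    have hvv : vert R G v * vert R G v * vert R G v = vert R G v := by rw [L.idem, L.idem]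
    rw [← hvv]
    refine vert_mem_of_forall_edge (hG v) fun e he => ?_
    have := mul_mem_componentMul_of_right
      (mul_mem_componentMul_of_left (edge_mem_component e) (ih (G.r e))) (ghost_mem_component e)
    subst he
    rw [← mul_assoc, L.source_edge, mul_assoc, L.ghost_source, ← L.edge_range e]
    convert this using 2 <;> push_cast <;> ring

/-- If `v ∉ L_{-k} L_k`, then repeated use of `α α^* = ∑ α e e^* α^*` gives an infinite path such
that `α α^* ∉ L_{-k} L_k` for all its initial subpaths `α`. This contradicts Condition (Y), since
`α α^* = (α β^*) (β α^*)` whenever `r(α) = r(β)`. -/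
theorem vert_mem_componentMul_neg (hG : ∀ v, G.IsRegular v) (hY : G.ConditionY) (k : ℕ) (v : V) :
    vert R G v ∈ componentMul R G (-k) k := by
  have L := isLeavittFamily R G
  by_contra hv
  obtain ⟨p, hp⟩ := exists_infinitePath_forall_take (G := G) (v := v)
    (fun α => pathElem R G α.source α.edges * ghostElem R G α.source α.edges ∉
      componentMul R G (-k) k)
    (by simpa only [FinitePath.nil, pathElem, ghostElem, L.idem] using hv)
    (by
      intro α hα
      by_contra! hall
      apply hα
      rw [← pathElem_mul_vert α.isPath]
      refine vert_mem_of_forall_edge (hG _) fun e he => ?_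
      have := hall e he
      rw [FinitePath.snoc, pathElem_append_singleton (he.symm ▸ α.isPath),
        ghostElem_append_singleton (he.symm ▸ α.isPath)] at this
      simpa only [mul_assoc] using this)
  obtain ⟨α, β, hα, hr, hk⟩ := hY k p
  apply hp α.length
  rw [← hα.eq_take]
  have := mul_mem_componentMul (pathElem_mul_ghostElem_mem (R := R) α β hr.symm (-k) (by omega))
    (pathElem_mul_ghostElem_mem (R := R) β α hr k (by omega))
  rwa [mul_assoc, ← mul_assoc (ghostElem R G β.source β.edges),
    ghostElem_mul_pathElem_self β.isPath, hr, vert_mul_ghostElem α.isPath] at this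

end StronglyGraded

end LeavittPathAlgebra

theorem theorem4p2 {V : Type*} {E : Type*} (G : DirectedGraph V E)
    {R : Type*} [CommRing R] [Nontrivial R] :
    IsStronglyGradedBy (fun n : ℤ => (LeavittPathAlgebra.component R G n).toAddSubgroup) ↔
      G.RowFinite ∧ G.NoSinks ∧ G.ConditionY := by
  open LeavittPathAlgebra in
  constructor
  · intro h
    have hv : ∀ (n : ℤ) (v : V), vert R G v ∈ componentMul R G n (-n) := by
      intro n v
      have hmem : vert R G v ∈ (component R G (n + -n)).toAddSubgroup := by
        rw [add_neg_cancel]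
        exact vert_mem_component v
      rwa [← h.mul_eq] at hmem
    have hreg : ∀ v, G.IsRegular v := fun v => isRegular_of_vert_mem_componentMul (hv 1 v)
    refine ⟨fun v => (hreg v).2, fun v => (hreg v).1, fun k p => ?_⟩
    exact exists_isInitialSubpath_of_vert_mem_componentMul (R := R) p k
      (by simpa using hv (-k) p.source)
  · rintro ⟨hrow, hsink, hY⟩
    have hreg : ∀ v, G.IsRegular v := fun v => ⟨hsink v, hrow v⟩
    refine ⟨isGradedBy_component R G, componentMul_eq_of_vert_mem fun v n => ?_⟩
    obtain ⟨k, rfl | rfl⟩ := n.eq_nat_or_neg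
    · exact vert_mem_componentMul_natCast hreg k v
    · rw [neg_neg]
      exact vert_mem_componentMul_neg hreg hY k v
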